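/- Let $G$ be any (discrete) group and $H\le G$ any subgroup. Let $\rho_G$ be the left regular representation of $G$ on $\ell^2(G)$, and let $\rho_{G/H}$ be the quasi-regular representation of $G$ on $\ell^2(G/H)$, $(\rho_{G/H}(g)f)(x)=f(g^{-1}x)$, where $G/H$ is the set of left cosets. Then $\rho_{G/H}$ is weakly contained in $\rho_G$ if and only if $H$ is amenable. Here a unitary representation $\pi$ of $G$ on a Hilbert space $V$ is weakly contained in a unitary representation $\sigma$ of $G$ on a Hilbert space $W$ if for every $v\in V$, every finite $Q\subseteq G$ and every $\varepsilon>0$ there are finitely many $w_1,\dots,w_n\in W$ with $\bigl|\langle\pi(g)v\mid v\rangle-\sum_{i=1}^n\langle\sigma(g)w_i\mid w_i\rangle\bigr|<\varepsilon$ for all $g\in Q$. The group $H$ is amenable if there is a finitely additive measure $\mu\ge 0$ defined on all subsets of $H$, with $\mu(H)=1$ and $\mu(hA)=\mu(A)$ for all $h\in H$ and $A\subseteq H$. -/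

import Mathlib

open scoped lp ENNReal

noncomputable section

/-- A unitary representation of the (discrete) group `G` on the inner product space `V`. -/
abbrev UnitaryRepr (G V : Type*) [Group G] [NormedAddCommGroup V] [InnerProductSpace ℂ V] :=
  G →* (V ≃ₗᵢ[ℂ] V)

/-- Weak containment `π ≺ σ` of unitary representations of a discrete group: every diagonal
matrix coefficient of `π` is approximated, uniformly on finite (that is, compact) subsets of `G`,
by finite sums of diagonal matrix coefficients of `σ`.
Mathlib's `inner ℂ x y` is linear in `y`, so the coefficient `g ↦ ⟨π(g)v | v⟩` of mathematicians'
convention (linear in the first slot) is `inner ℂ v (π g v)`. -/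
def WeaklyContained {G V W : Type*} [Group G]
    [NormedAddCommGroup V] [InnerProductSpace ℂ V] [CompleteSpace V]
    [NormedAddCommGroup W] [InnerProductSpace ℂ W] [CompleteSpace W]
    (π : UnitaryRepr G V) (σ : UnitaryRepr G W) : Prop :=
  ∀ (v : V) (Q : Finset G) (ε : ℝ), 0 < ε →
    ∃ (n : ℕ) (w : Fin n → W), ∀ g ∈ Q,
      ‖inner ℂ v (π g v) - ∑ i, inner ℂ (w i) (σ g (w i))‖ < ε

/-- Reindexing along a bijection preserves square-summability. -/
theorem memℓp_two_comp_equiv {X : Type*} (e : X ≃ X) {f : X → ℂ} (hf : Memℓp f 2) :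
    Memℓp (fun x => f (e x)) 2 := by
  have h2 : 0 < (2 : ℝ≥0∞).toReal := by norm_num
  rw [memℓp_gen_iff h2] at hf ⊢
  exact e.summable_iff.mpr hf

/-- The permutation representation of `G` on `ℓ²(X)` for an action of `G` on a set `X`:
`(g · f)(x) = f (g⁻¹ • x)`. -/
def permRepr (G X : Type*) [Group G] [MulAction G X] : UnitaryRepr G ℓ²(X, ℂ) where
  toFun g :=
    { toFun := fun f => ⟨fun x => f (g⁻¹ • x),
        memℓp_two_comp_equiv (MulAction.toPerm g⁻¹) (lp.memℓp f)⟩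
      invFun := fun f => ⟨fun x => f (g • x),
        memℓp_two_comp_equiv (MulAction.toPerm g) (lp.memℓp f)⟩
      map_add' := fun _ _ => rfl
      map_smul' := fun _ _ => rfl
      left_inv := fun f => by ext x; simp
      right_inv := fun f => by ext x; simp
      norm_map' := fun f => by
        have h2 : 0 < (2 : ℝ≥0∞).toReal := by norm_num
        rw [lp.norm_eq_tsum_rpow h2, lp.norm_eq_tsum_rpow h2]
        congr 1
        exact (MulAction.toPerm (g⁻¹) : Equiv.Perm X).tsum_eq
          (fun x => ‖f x‖ ^ (2 : ℝ≥0∞).toReal) }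
  map_one' := by ext f x; simp
  map_mul' g h := by
    ext f x
    simp only [mul_inv_rev, mul_smul]
    rfl

/-- The defining formula of the permutation representation. -/
theorem permRepr_apply {G X : Type*} [Group G] [MulAction G X] (g : G) (f : ℓ²(X, ℂ)) (x : X) :
    permRepr G X g f x = f (g⁻¹ • x) := rfl

/-- The (left) regular representation `ρ_G` of `G` on `ℓ²(G)`. -/
def regularRepr (G : Type*) [Group G] : UnitaryRepr G ℓ²(G, ℂ) := permRepr G G

/-- The quasi-regular representation `ρ_{G/H}` of `G` on `ℓ²(G/H)`, where `G/H` is the set of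
left cosets of `H` with the left translation action of `G`. -/
def quasiRegularRepr {G : Type*} [Group G] (H : Subgroup G) : UnitaryRepr G ℓ²(G ⧸ H, ℂ) :=
  permRepr G (G ⧸ H)

/-- An action of `G` on `X` is amenable (in the sense of von Neumann) if there is a finitely
additive measure, defined on all subsets of `X`, invariant under `G`, of total mass `1`. -/
def IsAmenableAction (G X : Type*) [Group G] [MulAction G X] : Prop :=
  ∃ μ : Set X → ℝ, (∀ A, 0 ≤ μ A) ∧ μ Set.univ = 1 ∧
    (∀ A B, Disjoint A B → μ (A ∪ B) = μ A + μ B) ∧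
    ∀ (g : G) (A : Set X), μ ((fun x => g • x) '' A) = μ A

/-- A group is amenable if its action on itself by left multiplication is amenable. -/
def IsAmenableGroup (G : Type*) [Group G] : Prop := IsAmenableAction G G

end

/-! If `H` is amenable, Reiter's condition (by Hahn–Banach) and pointwise square roots give unit
vectors of `ℓ²(G)`, supported on `H` and almost `H`-invariant. Their coefficients approximate the
indicator of `H`, which is the coefficient of `ρ_{G/H}` at the base coset. Combining translates
along coset representatives handles finitely supported vectors, which are dense.

Conversely, `H` fixes the point mass at the base coset, so `1` is approximated on `H` by sums of
coefficients of `ℓ²(G)`. The densities `∑ i, ‖w i x‖ ^ 2` on `G` are then almost `H`-invariant; a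
limit of the measures they define is invariant, and an `H`-equivariant map `G → H` pushes it to `H`.
-/

/-! ### Invariant means and Reiter's condition -/

/-- An invariant finitely additive probability measure integrates simple functions. -/
theorem IsAmenableAction.exists_mean {G X : Type*} [Group G] [MulAction G X]
    (h : IsAmenableAction G X) :
    letI : MeasurableSpace X := ⊤
    ∃ I : MeasureTheory.SimpleFunc X ℝ →+ ℝ,
      (∀ f g, f ≤ g → I f ≤ I g) ∧
      (∀ c, I (MeasureTheory.SimpleFunc.const X c) = c) ∧
      ∀ (g : G) (f f' : MeasureTheory.SimpleFunc X ℝ), (∀ x, f' x = f (g • x)) → I f' = I f := by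
  let _ : MeasurableSpace X := ⊤
  obtain ⟨μ, h0, h1, hadd, hinv⟩ := h
  let T : Set X → ℝ →L[ℝ] ℝ := fun A => μ A • ContinuousLinearMap.id ℝ ℝ
  -- The measure `0` only makes the finiteness side conditions trivial; `T` carries `μ`.
  have hT : MeasureTheory.FinMeasAdditive (0 : MeasureTheory.Measure X) T := by
    intro s t _ _ _ _ hst
    simp only [T, hadd s t hst, add_smul]
  have hempty : μ ∅ = 0 := by
    have := hadd ∅ ∅ (by simp)
    simp only [Set.union_empty] at this
    linarith
  refine ⟨AddMonoidHom.mk' (fun f => f.setToSimpleFunc T) fun f g =>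
    MeasureTheory.SimpleFunc.setToSimpleFunc_add T hT (by simp) (by simp), ?_, ?_, ?_⟩
  · intro f g hfg
    refine MeasureTheory.SimpleFunc.setToSimpleFunc_mono hT ?_ (by simp) (by simp) hfg
    intro s _ _ x hx
    exact mul_nonneg (h0 s) hx
  · intro c
    simp only [AddMonoidHom.mk'_apply]
    rw [MeasureTheory.SimpleFunc.setToSimpleFunc_const T (by simp [T, hempty])]
    simp [T, h1]
  · intro g f f' hf
    have hr : f'.range = f.range := by
      ext y
      simp only [MeasureTheory.SimpleFunc.mem_range, Set.mem_range, hf]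
      exact ⟨fun ⟨x, hx⟩ => ⟨g • x, hx⟩, fun ⟨x, hx⟩ => ⟨g⁻¹ • x, by simpa using hx⟩⟩
    simp only [AddMonoidHom.mk'_apply, MeasureTheory.SimpleFunc.setToSimpleFunc, hr]
    refine Finset.sum_congr rfl fun y _ => ?_
    have : f ⁻¹' {y} = (fun x => g • x) '' (f' ⁻¹' {y}) := by
      ext x
      simp only [Set.mem_preimage, Set.mem_singleton_iff, Set.mem_image, hf]
      exact ⟨fun hx => ⟨g⁻¹ • x, by simpa using hx, by simp⟩, by rintro ⟨z, hz, rfl⟩; exact hz⟩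
    simp only [T, this, hinv]

/-- For an amenable action, no finite sum of functions `x ↦ ψ (g • x) - ψ x` with `ψ` bounded
is bounded below by a positive constant. -/
theorem IsAmenableAction.not_forall_le_sum_sub {G X : Type*} [Group G] [MulAction G X]
    (h : IsAmenableAction G X) (F : Finset G) (ψ : G → X → ℝ) (C : ℝ)
    (hψ : ∀ g x, |ψ g x| ≤ C) {δ : ℝ} (hδ : 0 < δ) :
    ¬ ∀ x, δ ≤ ∑ g ∈ F, (ψ g (g • x) - ψ g x) := by
  intro H
  let _ : MeasurableSpace X := ⊤
  obtain ⟨I, hmono, hconst, hinv⟩ := h.exists_mean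
  -- Rounding `ψ / η` down to integers makes it simple and costs at most `1` per `g ∈ F`; since `δ /
  -- η = F.card + 1`, at least `1` survives.
  set η : ℝ := δ / (F.card + 1) with hη
  have hη0 : 0 < η := by positivity
  have hfin (g k : G) : (Set.range fun x => (⌊ψ g (k • x) / η⌋ : ℝ)).Finite := by
    refine ((Set.finite_Icc ⌊-(C / η)⌋ ⌊C / η⌋).image (fun z : ℤ => (z : ℝ))).subset ?_
    rintro _ ⟨x, rfl⟩
    obtain ⟨h1, h2⟩ := abs_le.mp (hψ g (k • x))
    refine ⟨_, ⟨Int.floor_mono ?_, Int.floor_mono ?_⟩, rfl⟩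
    · rw [← neg_div]; gcongr
    · gcongr
  let s : G → G → MeasureTheory.SimpleFunc X ℝ := fun g k =>
    ⟨fun x => (⌊ψ g (k • x) / η⌋ : ℝ), fun _ => trivial, hfin g k⟩
  have hs (g k : G) (x : X) : s g k x = (⌊ψ g (k • x) / η⌋ : ℝ) := rfl
  have hI : I (∑ g ∈ F, (s g g - s g 1)) = 0 := by
    rw [map_sum]
    refine Finset.sum_eq_zero fun g _ => ?_
    rw [map_sub, sub_eq_zero]
    exact hinv g _ _ fun x => by simp [hs]
  have hle : MeasureTheory.SimpleFunc.const X (1 : ℝ) ≤ ∑ g ∈ F, (s g g - s g 1) := by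
    intro x
    have hsum (t : Finset G) : (∑ g ∈ t, (s g g - s g 1)) x = ∑ g ∈ t, (s g g x - s g 1 x) := by
      classical
      induction t using Finset.induction_on with
      | empty => simp
      | insert a t ha ih =>
        rw [Finset.sum_insert ha, Finset.sum_insert ha, MeasureTheory.SimpleFunc.coe_add,
          Pi.add_apply, ih]
        rfl
    rw [hsum]
    have h3 : ∑ g ∈ F, ((ψ g (g • x) - ψ g x) / η - 1) ≤ ∑ g ∈ F, (s g g x - s g 1 x) := by
      refine Finset.sum_le_sum fun g _ => ?_
      rw [hs, hs, one_smul, sub_div]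
      linarith [Int.sub_one_lt_floor (ψ g (g • x) / η), Int.floor_le (ψ g x / η)]
    refine le_trans ?_ h3
    rw [Finset.sum_sub_distrib, ← Finset.sum_div]
    have h4 : δ / η ≤ (∑ g ∈ F, (ψ g (g • x) - ψ g x)) / η := by gcongr; exact H x
    have h5 : δ / η = F.card + 1 := by rw [hη]; field_simp
    simp only [MeasureTheory.SimpleFunc.const_apply, Finset.sum_const, nsmul_eq_mul, mul_one]
    linarith
  have := hmono _ _ hle
  rw [hI, hconst] at this
  linarith

theorem memℓp_one_comp_equiv {X : Type*} (e : X ≃ X) {f : X → ℝ} (hf : Memℓp f 1) :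
    Memℓp (fun x => f (e x)) 1 := by
  have h2 : 0 < (1 : ℝ≥0∞).toReal := by norm_num
  rw [memℓp_gen_iff h2] at hf ⊢
  exact e.summable_iff.mpr hf

/-- Left translation on `ℓ¹`. -/
def lpOneTranslate {G X : Type*} [Group G] [MulAction G X] (g : G) : ℓ¹(X, ℝ) →ₗ[ℝ] ℓ¹(X, ℝ) where
  toFun f := ⟨fun x => f (g⁻¹ • x), memℓp_one_comp_equiv (MulAction.toPerm g⁻¹) (lp.memℓp f)⟩
  map_add' _ _ := rfl
  map_smul' _ _ := rfl

theorem lpOneTranslate_apply {G X : Type*} [Group G] [MulAction G X] (g : G) (f : ℓ¹(X, ℝ))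
    (x : X) : lpOneTranslate g f x = f (g⁻¹ • x) := rfl

theorem lpOneTranslate_single {G X : Type*} [Group G] [MulAction G X] [DecidableEq X] (g : G)
    (x : X) (a : ℝ) : lpOneTranslate g (lp.single 1 x a : ℓ¹(X, ℝ)) = lp.single 1 (g • x) a := by
  ext y
  rw [lpOneTranslate_apply, lp.single_apply, lp.single_apply, Pi.single_apply, Pi.single_apply]
  simp only [inv_smul_eq_iff]

/-- **Reiter's condition**: if `X → Y` is equivariant and the action on `X` is amenable, there
are almost invariant probability densities on `Y` supported in the range of `X`. -/
theorem IsAmenableAction.exists_almost_invariant {G X Y : Type*} [Group G] [MulAction G X]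
    [MulAction G Y] (h : IsAmenableAction G X) (φ : X →[G] Y) (F : Finset G) {ε : ℝ}
    (hε : 0 < ε) :
    ∃ q : ℓ¹(Y, ℝ), (∀ y, 0 ≤ q y) ∧ HasSum q 1 ∧ (∀ y ∉ Set.range φ, q y = 0) ∧
      ∀ g ∈ F, ‖lpOneTranslate g q - q‖ < ε := by
  classical
  let P : Set ℓ¹(Y, ℝ) := {q | (∀ y, 0 ≤ q y) ∧ HasSum q 1 ∧ ∀ y ∉ Set.range φ, q y = 0}
  have hP : Convex ℝ P := by
    rintro p ⟨hp1, hp2, hp3⟩ q ⟨hq1, hq2, hq3⟩ a b ha hb hab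
    refine ⟨fun y => ?_, ?_, fun y hy => ?_⟩
    · exact add_nonneg (mul_nonneg ha (hp1 y)) (mul_nonneg hb (hq1 y))
    · have := (hp2.mul_left a).add (hq2.mul_left b)
      rw [mul_one, mul_one, hab] at this
      exact this
    · change a * p y + b * q y = 0
      rw [hp3 y hy, hq3 y hy]; simp
  let D : ℓ¹(Y, ℝ) →ₗ[ℝ] (F → ℓ¹(Y, ℝ)) :=
    LinearMap.pi fun g => lpOneTranslate g.1 - LinearMap.id
  by_cases h0 : (0 : F → ℓ¹(Y, ℝ)) ∈ closure (D '' P)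
  · obtain ⟨_, ⟨q, ⟨hq1, hq2, hq3⟩, rfl⟩, hq⟩ := Metric.mem_closure_iff.mp h0 ε hε
    refine ⟨q, hq1, hq2, hq3, fun g hg => ?_⟩
    rw [dist_zero_left] at hq
    exact (norm_le_pi_norm (D q) ⟨g, hg⟩).trans_lt hq
  · exfalso
    obtain ⟨f, u, hf0, hfu⟩ :=
      geometric_hahn_banach_point_closed (hP.linear_image D).closure isClosed_closure h0
    rw [map_zero] at hf0
    -- Evaluating the separating functional at `D` of the point mass at `φ x` gives `∑ g ∈ F, (ψ g
    -- (g • x) - ψ g x)`.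
    let ψ : G → X → ℝ := fun g x =>
      if hg : g ∈ F then f (Pi.single ⟨g, hg⟩ (lp.single 1 (φ x) 1)) else 0
    refine h.not_forall_le_sum_sub F ψ ‖f‖ ?_ hf0 fun x => ?_
    · intro g x
      by_cases hg : g ∈ F
      · simp only [ψ, hg, dif_pos, ← Real.norm_eq_abs]
        refine (f.le_opNorm _).trans ?_
        rw [Pi.norm_single, lp.norm_single (by norm_num)]
        simp
      · simp [ψ, hg]
    · have hx : (lp.single 1 (φ x) 1 : ℓ¹(Y, ℝ)) ∈ P := by
        refine ⟨fun y => ?_, ?_, fun y hy => ?_⟩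
        · rw [lp.single_apply, Pi.single_apply]; split_ifs <;> norm_num
        · rw [lp.coeFn_single]; exact hasSum_pi_single _ _
        · exact lp.single_apply_ne _ _ _ fun h => hy ⟨x, h.symm⟩
      refine (hfu _ (subset_closure ⟨_, hx, rfl⟩)).le.trans_eq ?_
      rw [← Finset.univ_sum_single (D (lp.single 1 (φ x) 1)), map_sum, ← Finset.sum_attach F]
      refine Finset.sum_congr rfl fun g _ => ?_
      simp only [ψ, g.2, dif_pos, Subtype.coe_eta, ← map_sub, ← Pi.single_sub, map_smul]
      simp [D, lpOneTranslate_single]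

/-! ### From amenability to weak containment -/

/-- The pointwise square root of a probability density almost invariant in `ℓ¹` is a unit vector
almost invariant in `ℓ²`. -/
theorem norm_one_sub_inner_permRepr_le {G X : Type*} [Group G] [MulAction G X] {q : ℓ¹(X, ℝ)}
    (h0 : ∀ x, 0 ≤ q x) (h1 : HasSum q 1) {η : ℓ²(X, ℂ)} (hη : ∀ x, η x = (√(q x) : ℝ)) (g : G) :
    ‖1 - inner ℂ η (permRepr G X g η)‖ ≤ ‖lpOneTranslate g q - q‖ := by
  have hD : HasSum (fun x => |q (g⁻¹ • x) - q x|) ‖lpOneTranslate g q - q‖ := by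
    simpa [lpOneTranslate_apply] using lp.hasSum_norm (p := 1) (by norm_num) (lpOneTranslate g q - q)
  have h1' : HasSum (fun x => q (g⁻¹ • x)) 1 := (MulAction.toPerm g⁻¹).hasSum_iff.mpr h1
  have hI := lp.hasSum_inner (𝕜 := ℂ) η (permRepr G X g η)
  have hterm (x : X) : inner ℂ (η x) (permRepr G X g η x)
      = ((√(q x) * √(q (g⁻¹ • x)) : ℝ) : ℂ) := by
    rw [permRepr_apply, hη, hη]
    simp [mul_comm]
  simp only [hterm] at hI
  have hr : ((inner ℂ η (permRepr G X g η)).re : ℂ) = inner ℂ η (permRepr G X g η) :=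
    (hI.unique (by exact_mod_cast (Complex.hasSum_re hI))).symm
  have hR : HasSum (fun x => √(q x) * √(q (g⁻¹ • x))) (inner ℂ η (permRepr G X g η)).re := by
    simpa using Complex.hasSum_re hI
  set r := (inner ℂ η (permRepr G X g η)).re
  have hd := ((h1.add h1').div_const 2).sub hR
  have e (x : X) : (q x + q (g⁻¹ • x)) / 2 - √(q x) * √(q (g⁻¹ • x))
      = (√(q x) - √(q (g⁻¹ • x))) ^ 2 / 2 := by
    nlinarith [Real.sq_sqrt (h0 x), Real.sq_sqrt (h0 (g⁻¹ • x))]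
  have hlo : (0 : ℝ) ≤ (1 + 1) / 2 - r := hd.nonneg fun x => by rw [e]; positivity
  have hup : (1 + 1) / 2 - r ≤ ‖lpOneTranslate g q - q‖ := by
    refine hasSum_le (fun x => ?_) hd hD
    rw [e]
    have ha := Real.sqrt_nonneg (q x)
    have hb := Real.sqrt_nonneg (q (g⁻¹ • x))
    rw [← Real.sq_sqrt (h0 x), ← Real.sq_sqrt (h0 (g⁻¹ • x)), Real.sqrt_sq ha, Real.sqrt_sq hb]
    rcases le_total (√(q x)) (√(q (g⁻¹ • x))) with h | h
    · refine le_trans ?_ (le_abs_self _); nlinarith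
    · refine le_trans ?_ (neg_le_abs _); nlinarith
  rw [← hr, ← Complex.ofReal_one, ← Complex.ofReal_sub, Complex.norm_real, Real.norm_eq_abs,
    abs_of_nonneg (by linarith)]
  linarith

/-- If `H` is amenable, the indicator function of `H` is a limit of diagonal coefficients of the
regular representation of `G`. -/
theorem exists_norm_indicator_sub_inner_lt {G : Type*} [Group G] {H : Subgroup G}
    (h : IsAmenableGroup H) (F : Finset G) {ε : ℝ} (hε : 0 < ε) :
    ∃ η : ℓ²(G, ℂ), ∀ k ∈ F,
      ‖(H : Set G).indicator 1 k - inner ℂ η (regularRepr G k η)‖ < ε := by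
  classical
  let φ : H →[H] G := ⟨Subtype.val, fun _ _ => rfl⟩
  obtain ⟨q, hq0, hq1, hq2, hq⟩ :=
    IsAmenableAction.exists_almost_invariant h φ (F.subtype (· ∈ H)) hε
  have hmem : Memℓp (fun x => ((√(q x) : ℝ) : ℂ)) 2 := by
    refine memℓp_gen ?_
    simpa [Real.sq_sqrt, hq0] using hq1.summable
  refine ⟨⟨_, hmem⟩, fun k hk => ?_⟩
  by_cases hkH : k ∈ H
  · rw [Set.indicator_of_mem hkH, Pi.one_apply]
    exact (norm_one_sub_inner_permRepr_le hq0 hq1 (fun _ => rfl) k).trans_lt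
      (hq ⟨k, hkH⟩ (by simpa using hk))
  · rw [Set.indicator_of_notMem hkH, lp.inner_eq_tsum]
    have hz (y : G) (hy : y ∉ H) : q y = 0 := hq2 y (by rintro ⟨z, rfl⟩; exact hy z.2)
    refine lt_of_eq_of_lt ?_ hε
    rw [zero_sub, norm_neg, norm_eq_zero]
    -- For `k ∉ H`, `y` and `k⁻¹ * y` are never both in `H`, so the vector and its translate have
    -- disjoint supports.
    convert tsum_zero with y
    simp only [regularRepr, permRepr_apply, smul_eq_mul]
    by_cases hy : y ∈ H
    · rw [hz (k⁻¹ * y) fun h' => hkH (by simpa using H.mul_mem hy (H.inv_mem h'))]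
      simp
    · rw [hz y hy]; simp

theorem inner_single_permRepr_single {G X : Type*} [Group G] [MulAction G X] [DecidableEq X]
    (g : G) (x y : X) (a b : ℂ) :
    inner ℂ (lp.single 2 x a : ℓ²(X, ℂ)) (permRepr G X g (lp.single 2 y b))
      = star a * b * if g • y = x then 1 else 0 := by
  rw [lp.inner_single_left, permRepr_apply, lp.single_apply, Pi.single_apply]
  simp only [inv_smul_eq_iff]
  by_cases hxy : g • y = x
  · simp [hxy, mul_comm]
  · simp [hxy, Ne.symm hxy]

theorem inner_unitaryRepr_unitaryRepr {G V : Type*} [Group G] [NormedAddCommGroup V]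
    [InnerProductSpace ℂ V] (σ : UnitaryRepr G V) (s g t : G) (v : V) :
    inner ℂ (σ s v) (σ g (σ t v)) = inner ℂ v (σ (s⁻¹ * g * t) v) := by
  have h : σ g (σ t v) = σ s (σ (s⁻¹ * g * t) v) := by
    change (σ g * σ t) v = (σ s * σ (s⁻¹ * g * t)) v
    rw [← map_mul, ← map_mul]
    congr 2
    group
  rw [h, LinearIsometryEquiv.inner_map_map]

theorem IsAmenableGroup.weaklyContained {G : Type*} [Group G] {H : Subgroup G}
    (h : IsAmenableGroup H) : WeaklyContained (quasiRegularRepr H) (regularRepr G) := by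
  classical
  intro v Q ε hε
  have hlim : ∀ᶠ S : Finset (G ⧸ H) in Filter.atTop, ∀ g ∈ Q,
      ‖inner ℂ v (quasiRegularRepr H g v) - inner ℂ (∑ x ∈ S, lp.single 2 x (v x))
        (quasiRegularRepr H g (∑ x ∈ S, lp.single 2 x (v x)))‖ < ε / 2 := by
    rw [Filter.eventually_all_finset]
    intro g _
    have hc : Continuous fun u : ℓ²(G ⧸ H, ℂ) => inner ℂ u (quasiRegularRepr H g u) :=
      continuous_id.inner (quasiRegularRepr H g).continuous
    have := (hc.tendsto v).comp (lp.hasSum_single (by norm_num) v)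
    filter_upwards [Metric.tendsto_nhds.mp this (ε / 2) (half_pos hε)] with S hS
    rwa [dist_comm, dist_eq_norm] at hS
  obtain ⟨S, hS⟩ := hlim.exists
  set M : ℝ := ∑ x ∈ S, ∑ y ∈ S, ‖star (v y) * v x‖
  have hM : 0 ≤ M := by positivity
  let s : G ⧸ H → G := Quotient.out
  have hs (x : G ⧸ H) : (s x : G ⧸ H) = x := Quotient.out_eq x
  obtain ⟨η, hη⟩ := exists_norm_indicator_sub_inner_lt h
    ((S ×ˢ Q ×ˢ S).image fun p => (s p.1)⁻¹ * p.2.1 * s p.2.2)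
    (ε := ε / (2 * (M + 1))) (by positivity)
  -- One vector suffices: its cross terms are coefficients of `η` at `(s y)⁻¹ * g * s x`, which lies
  -- in `H` exactly when `g • x = y`.
  refine ⟨1, fun _ => ∑ x ∈ S, v x • regularRepr G (s x) η, fun g hg => ?_⟩
  rw [Fin.sum_univ_one]
  have key : ‖inner ℂ (∑ x ∈ S, lp.single 2 x (v x))
        (quasiRegularRepr H g (∑ x ∈ S, lp.single 2 x (v x))) -
      inner ℂ (∑ x ∈ S, v x • regularRepr G (s x) η)
        (regularRepr G g (∑ x ∈ S, v x • regularRepr G (s x) η))‖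
      ≤ M * (ε / (2 * (M + 1))) := by
    simp only [map_sum, sum_inner, inner_sum, map_smul, inner_smul_left, inner_smul_right,
      inner_unitaryRepr_unitaryRepr, Finset.mul_sum]
    rw [← Finset.sum_sub_distrib, Finset.sum_mul]
    refine (norm_sum_le _ _).trans (Finset.sum_le_sum fun x hx => ?_)
    rw [← Finset.sum_sub_distrib, Finset.sum_mul]
    refine (norm_sum_le _ _).trans (Finset.sum_le_sum fun y hy => ?_)
    have hind : (H : Set G).indicator (1 : G → ℂ) ((s y)⁻¹ * g * s x)
        = if g • x = y then 1 else 0 := by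
      have : (s y)⁻¹ * g * s x ∈ (H : Set G) ↔ g • x = y := by
        rw [SetLike.mem_coe, mul_assoc, ← QuotientGroup.eq, eq_comm, hs]
        conv_rhs => rw [← hs x]
        rfl
      simp only [Set.indicator_apply, this, Pi.one_apply]
    have h1 := hη _ (Finset.mem_image_of_mem _
      (Finset.mk_mem_product hy (Finset.mk_mem_product hg hx)))
    rw [quasiRegularRepr, inner_single_permRepr_single, ← hind, starRingEnd_apply,
      mul_left_comm, ← mul_assoc, ← mul_sub, norm_mul]
    gcongr
  have hlt : M * (ε / (2 * (M + 1))) < ε / 2 := by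
    rw [← mul_div_assoc, div_lt_div_iff₀ (by positivity) (by norm_num)]
    nlinarith
  calc _ ≤ _ := norm_sub_le_norm_sub_add_norm_sub _ _ _
    _ < ε / 2 + ε / 2 := add_lt_add (hS g hg) (key.trans_lt hlt)
    _ = ε := add_halves ε

/-! ### From weak containment to amenability -/

open Filter Topology in
/-- A limit of almost invariant finitely additive measures is an invariant one. -/
theorem isAmenableAction_of_forall_exists {G X : Type*} [Group G] [MulAction G X]
    (h : ∀ (Q : Finset G) (t : ℝ), 0 < t → ∃ ν : Set X → ℝ, (∀ A, 0 ≤ ν A ∧ ν A ≤ 2) ∧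
      |ν Set.univ - 1| ≤ t ∧ (∀ A B, Disjoint A B → ν (A ∪ B) = ν A + ν B) ∧
      ∀ g ∈ Q, ∀ A, |ν ((fun x => g • x) '' A) - ν A| ≤ t) :
    IsAmenableAction G X := by
  classical
  choose ν hν hν1 hνadd hνinv using fun p : Finset G × ℕ =>
    h p.1 (1 / ((p.2 : ℝ) + 1)) (by positivity)
  let U : Ultrafilter (Finset G × ℕ) := Ultrafilter.of atTop
  have hU : (U : Filter (Finset G × ℕ)) ≤ atTop := Ultrafilter.of_le _
  have hK : IsCompact (Set.univ.pi fun _ : Set X => Set.Icc (0 : ℝ) 2) :=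
    isCompact_univ_pi fun _ => isCompact_Icc
  obtain ⟨μ, hμ, hlim⟩ := hK.ultrafilter_le_nhds (U.map ν)
    (by
      rw [Ultrafilter.coe_map, le_principal_iff, mem_map]
      exact univ_mem' fun p A _ => hν p A)
  have hlim' (A : Set X) : Tendsto (fun p => ν p A) U (𝓝 (μ A)) :=
    tendsto_pi_nhds.mp (hlim : Tendsto ν U (𝓝 μ)) A
  have h0 : Tendsto (fun p : Finset G × ℕ => 1 / ((p.2 : ℝ) + 1)) U (𝓝 0) := by
    refine (tendsto_one_div_add_atTop_nhds_zero_nat.comp tendsto_snd).mono_left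
      (hU.trans_eq (prod_atTop_atTop_eq (α := Finset G) (β := ℕ)).symm)
  refine ⟨μ, fun A => (hμ A trivial).1, ?_, fun A B hAB => ?_, fun g A => ?_⟩
  · refine sub_eq_zero.mp (tendsto_nhds_unique ((hlim' Set.univ).sub_const 1) ?_)
    exact squeeze_zero_norm hν1 h0
  · refine tendsto_nhds_unique (hlim' (A ∪ B)) ?_
    simp only [hνadd _ A B hAB]
    exact (hlim' A).add (hlim' B)
  · refine sub_eq_zero.mp (tendsto_nhds_unique ((hlim' _).sub (hlim' A)) ?_)
    refine squeeze_zero_norm' ?_ h0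
    filter_upwards [hU (eventually_ge_atTop ({g}, 0))] with p hp
    exact hνinv p g (hp.1 (Finset.mem_singleton_self g)) A

theorem IsAmenableAction.map {G X Y : Type*} [Group G] [MulAction G X] [MulAction G Y]
    (h : IsAmenableAction G X) (φ : X →[G] Y) : IsAmenableAction G Y := by
  obtain ⟨μ, h0, h1, hadd, hinv⟩ := h
  refine ⟨fun A => μ (φ ⁻¹' A), fun A => h0 _, h1, fun A B hAB => ?_, fun g A => ?_⟩
  · beta_reduce
    rw [Set.preimage_union]
    exact hadd _ _ (hAB.preimage φ)
  · beta_reduce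
    rw [← hinv g (φ ⁻¹' A)]
    congr 1
    ext x
    simp only [Set.mem_preimage, Set.mem_image]
    constructor
    · rintro ⟨y, hy, hyx⟩
      exact ⟨g⁻¹ • x, by rwa [map_smul, ← hyx, inv_smul_smul], smul_inv_smul _ _⟩
    · rintro ⟨z, hz, rfl⟩
      exact ⟨φ z, hz, (map_smul φ g z).symm⟩

theorem hasSum_sq_norm {X : Type*} (w : ℓ²(X, ℂ)) : HasSum (fun x => ‖w x‖ ^ 2) (‖w‖ ^ 2) := by
  simpa using lp.hasSum_norm (p := 2) (by norm_num) w

/-- Weighted AM–GM on `‖a - b‖ * (‖a‖ + ‖b‖)`; it replaces Cauchy–Schwarz when summing over `i` and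
`x`. -/
theorem abs_sq_norm_sub_sq_norm_le {E : Type*} [SeminormedAddCommGroup E] (a b : E) {t : ℝ}
    (ht : 0 < t) :
    |‖b‖ ^ 2 - ‖a‖ ^ 2| ≤ t⁻¹ * ‖a - b‖ ^ 2 + t * (‖a‖ ^ 2 + ‖b‖ ^ 2) := by
  have h1 : |‖b‖ - ‖a‖| ≤ ‖a - b‖ := by rw [norm_sub_rev]; exact abs_norm_sub_norm_le b a
  have h2 : |‖b‖ ^ 2 - ‖a‖ ^ 2| ≤ ‖a - b‖ * (‖a‖ + ‖b‖) := by
    rw [sq_sub_sq, abs_mul, abs_of_nonneg (by positivity : 0 ≤ ‖b‖ + ‖a‖), mul_comm, add_comm ‖b‖]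
    gcongr
  have h3 : ‖a - b‖ = t * (t⁻¹ * ‖a - b‖) := by field_simp
  have h4 : t⁻¹ * ‖a - b‖ ^ 2 = t * (t⁻¹ * ‖a - b‖) ^ 2 := by field_simp
  refine h2.trans ?_
  rw [h4]
  nth_rewrite 1 [h3]
  rw [mul_assoc, ← mul_add]
  gcongr
  generalize t⁻¹ * ‖a - b‖ = c
  nlinarith [sq_nonneg (c - ‖a‖ - ‖b‖), sq_nonneg (‖a‖ - ‖b‖), sq_nonneg c]

/-- If the trivial coefficient `1` is approximated by sums of diagonal coefficients of the
permutation representation on `ℓ²(X)`, then the action on `X` is amenable. -/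
theorem isAmenableAction_of_coefficients {G X : Type*} [Group G] [MulAction G X]
    (h : ∀ (Q : Finset G) (ε : ℝ), 0 < ε → ∃ (n : ℕ) (w : Fin n → ℓ²(X, ℂ)), ∀ g ∈ Q,
      ‖1 - ∑ i, inner ℂ (w i) (permRepr G X g (w i))‖ < ε) :
    IsAmenableAction G X := by
  classical
  refine isAmenableAction_of_forall_exists fun Q t ht => ?_
  set τ : ℝ := min (t / 8) (1 / 8) with hτ
  have hτ0 : 0 < τ := by positivity
  have hτt : 8 * τ ≤ t := by linarith [min_le_left (t / 8) (1 / 8)]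
  have hτ1 : τ ≤ 1 / 8 := min_le_right _ _
  have hττ : τ ^ 2 ≤ τ / 8 := by nlinarith
  -- The element `1` controls the total mass `N`; inverses occur because `w i (g • x)` is the
  -- translate of `w i` by `g⁻¹`. The final error is at most `4 * τ + 2 * τ * N ≤ 8 * τ`.
  obtain ⟨n, w, hw⟩ := h (insert 1 (Q.image fun g => g⁻¹)) (τ ^ 2) (by positivity)
  set N : ℝ := ∑ i, ‖w i‖ ^ 2 with hN
  have hN1 : |1 - N| < τ ^ 2 := by
    have h1 := hw 1 (Finset.mem_insert_self _ _)
    simp only [map_one, LinearIsometryEquiv.coe_one, id_eq, inner_self_eq_norm_sq_to_K] at h1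
    rw [← Real.norm_eq_abs, ← Complex.norm_real]
    simpa [hN] using h1
  obtain ⟨hNl, hNu⟩ := abs_lt.mp hN1
  set ρ : X → ℝ := fun x => ∑ i, ‖w i x‖ ^ 2 with hρ
  have hρ0 (x : X) : 0 ≤ ρ x := by positivity
  have hρN : HasSum ρ N := hasSum_sum fun i _ => hasSum_sq_norm (w i)
  clear_value ρ
  have hsum (A : Set X) : Summable (A.indicator ρ) := hρN.summable.indicator A
  have hind0 (A : Set X) (x : X) : 0 ≤ A.indicator ρ x := Set.indicator_nonneg (fun x _ => hρ0 x) x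
  refine ⟨fun A => ∑' x, A.indicator ρ x, fun A => ⟨tsum_nonneg (hind0 A), ?_⟩, ?_,
    fun A B hAB => ?_, fun g hg A => ?_⟩
  · have : ∑' x, A.indicator ρ x ≤ N :=
      hasSum_le (Set.indicator_le_self' fun x _ => hρ0 x) (hsum A).hasSum hρN
    linarith
  · beta_reduce
    rw [Set.indicator_univ, hρN.tsum_eq, abs_sub_comm]
    linarith
  · beta_reduce
    rw [← (hsum A).tsum_add (hsum B), Set.indicator_union_of_disjoint hAB]
  · have himg : ∑' x, ((fun x => g • x) '' A).indicator ρ x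
        = ∑' x, A.indicator (fun x => ρ (g • x)) x := by
      refine ((MulAction.toPerm g : Equiv.Perm X).tsum_eq _).symm.trans (tsum_congr fun x => ?_)
      rw [MulAction.toPerm_apply]
      by_cases hx : x ∈ A
      · rw [Set.indicator_of_mem (Set.mem_image_of_mem _ hx), Set.indicator_of_mem hx]
      · rw [Set.indicator_of_notMem (by rwa [(MulAction.injective g).mem_set_image]),
          Set.indicator_of_notMem hx]
    have hσ : HasSum (fun x => ρ (g • x)) N :=
      (MulAction.toPerm g : Equiv.Perm X).hasSum_iff.mpr hρN
    beta_reduce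
    rw [himg, ← (hσ.summable.indicator A).tsum_sub (hsum A)]
    set u : Fin n → ℓ²(X, ℂ) := fun i => permRepr G X g⁻¹ (w i) with hu
    have hbd : HasSum (fun x => ∑ i, (τ⁻¹ * ‖(w i - u i) x‖ ^ 2 + τ * (‖w i x‖ ^ 2 + ‖u i x‖ ^ 2)))
        (∑ i, (τ⁻¹ * ‖w i - u i‖ ^ 2 + τ * (‖w i‖ ^ 2 + ‖u i‖ ^ 2))) :=
      hasSum_sum fun i _ => ((hasSum_sq_norm _).mul_left _).add
        (((hasSum_sq_norm _).add (hasSum_sq_norm _)).mul_left _)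
    rw [← Real.norm_eq_abs]
    refine (tsum_of_norm_bounded hbd fun x => ?_).trans ?_
    · have h1 : ‖A.indicator (fun x => ρ (g • x)) x - A.indicator ρ x‖ ≤ |ρ (g • x) - ρ x| := by
        by_cases hx : x ∈ A <;> simp [hx]
      refine h1.trans ?_
      rw [hρ]
      simp only
      rw [← Finset.sum_sub_distrib]
      refine (Finset.abs_sum_le_sum_abs _ _).trans (Finset.sum_le_sum fun i _ => ?_)
      have : w i (g • x) = u i x := by rw [hu, permRepr_apply, inv_inv]
      rw [this, lp.coeFn_sub, Pi.sub_apply]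
      exact abs_sq_norm_sub_sq_norm_le _ _ hτ0
    · have hun (i : Fin n) : ‖u i‖ = ‖w i‖ := (permRepr G X g⁻¹).norm_map (w i)
      have hdiff : ∑ i, ‖w i - u i‖ ^ 2 ≤ 4 * τ ^ 2 := by
        have h1 := hw g⁻¹ (Finset.mem_insert_of_mem (Finset.mem_image_of_mem _ hg))
        have h2 := (Complex.abs_re_le_norm _).trans_lt h1
        rw [Complex.sub_re, Complex.one_re, Complex.re_sum] at h2
        have h3 : ∑ i, ‖w i - u i‖ ^ 2 = 2 * N - 2 * ∑ i, (inner ℂ (w i) (u i)).re := by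
          rw [hN, Finset.mul_sum, Finset.mul_sum, ← Finset.sum_sub_distrib]
          refine Finset.sum_congr rfl fun i _ => ?_
          rw [@norm_sub_sq ℂ, hun]
          simp only [RCLike.re_to_complex]
          ring
        rw [h3]
        linarith [(abs_lt.mp h2).2]
      simp only [hun]
      rw [Finset.sum_add_distrib, ← Finset.mul_sum, ← Finset.mul_sum, Finset.sum_add_distrib, ← hN]
      have h5 : τ⁻¹ * ∑ i, ‖w i - u i‖ ^ 2 ≤ 4 * τ := by
        calc _ ≤ τ⁻¹ * (4 * τ ^ 2) := by gcongr
          _ = 4 * τ := by field_simp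
      nlinarith

/-- The subgroup `H` acting on `G` by left multiplication maps equivariantly to `H`. -/
theorem Subgroup.exists_mulActionHom {G : Type*} [Group G] (H : Subgroup G) :
    Nonempty (G →[H] H) := by
  -- `s` picks representatives of the cosets `H g`, so it is unchanged by left multiplication by
  -- `H`.
  let s : G → G := fun g => (Quotient.mk (QuotientGroup.rightRel H) g).out
  have hs (g : G) : g * (s g)⁻¹ ∈ H :=
    QuotientGroup.rightRel_apply.mp (Quotient.mk_out (s := QuotientGroup.rightRel H) g)
  refine ⟨⟨fun g => ⟨g * (s g)⁻¹, hs g⟩, fun h g => ?_⟩⟩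
  have : s (h • g) = s g := by
    have : Quotient.mk (QuotientGroup.rightRel H) (h • g) = Quotient.mk _ g :=
      Quotient.sound (MulAction.mem_orbit g h)
    simp only [s, this]
  apply Subtype.ext
  simp only [this]
  exact mul_assoc _ _ _

theorem WeaklyContained.isAmenableGroup {G : Type*} [Group G] {H : Subgroup G}
    (h : WeaklyContained (quasiRegularRepr H) (regularRepr G)) : IsAmenableGroup H := by
  classical
  obtain ⟨φ⟩ := H.exists_mulActionHom
  refine IsAmenableAction.map (isAmenableAction_of_coefficients fun Q ε hε => ?_) φ
  obtain ⟨n, w, hw⟩ := h (lp.single 2 ((1 : G) : G ⧸ H) 1) (Q.image Subtype.val) ε hε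
  refine ⟨n, w, fun g hg => ?_⟩
  have h1 := hw g (Finset.mem_image_of_mem _ hg)
  have h2 : (g : G) • ((1 : G) : G ⧸ H) = ((1 : G) : G ⧸ H) := by
    change (((g : G) * 1 : G) : G ⧸ H) = _
    rw [eq_comm, QuotientGroup.eq]
    simp
  rw [quasiRegularRepr, inner_single_permRepr_single, h2, star_one, one_mul, if_pos rfl,
    one_mul] at h1
  -- Restricted to `H`, `regularRepr G` is definitionally `permRepr H G`.
  exact h1

theorem mainTheorem12 {G : Type*} [Group G] (H : Subgroup G) :
    WeaklyContained (quasiRegularRepr H) (regularRepr G) ↔ IsAmenableGroup H :=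
  ⟨WeaklyContained.isAmenableGroup, IsAmenableGroup.weaklyContained⟩
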